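/- Let $Z=(X,A,Y)\sim P$ with covariates $X$ in a measurable space, a continuous treatment $A\in\mathbb R$ and an integrable real outcome $Y$. Let $\pi(a|x)$ be the conditional density of $A$ given $X=x$ and $\mu(x,a)=\mathbb E[Y|X=x,A=a]$. Let $K_h(u)=K(u/h)/h$ with a measurable kernel $K$ and a fixed bandwidth $h>0$, and fix a treatment value $a$ and a threshold $t$. Let $S(p,t)$ be a smoothed version of the indicator $\mathbb I(p>t)$ which is differentiable in $p$, with a bounded and Lipschitz derivative $\partial S/\partial\pi$. Put $$\psi_h^{\rm num}(a;t)=\int\!\!\int K_h(a_0-a)S(\pi(a_0|x),t)\mu(x,a_0)\,da_0\,dP(x),\qquad \psi_h^{\rm den}(a;t)=\int\!\!\int K_h(a_0-a)S(\pi(a_0|x),t)\,da_0\,dP(x),$$ assume $\psi_h^{\rm den}(a;t)\neq0$, and let $\psi_h=\psi_h^{\rm num}/\psi_h^{\rm den}$. The uncentered efficient influence functions (EIFs) are $$\varphi_h^{\rm num}=K_h(A-a)\frac{\{Y-\mu(X,A)\}S(\pi(A|X),t)}{\pi(A|X)}+\int K_h(a_0-a)S(\pi(a_0|X),t)\mu(X,a_0)\,da_0$$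 $$\qquad+K_h(A-a)\mu(X,A)\frac{\partial S(\pi(A|X),t)}{\partial\pi}-\int K_h(a_0-a)\mu(X,a_0)\frac{\partial S(\pi(a_0|X),t)}{\partial\pi}\pi(a_0|X)\,da_0,$$ $$\varphi_h^{\rm den}=\int K_h(a_0-a)S(\pi(a_0|X),t)\,da_0+K_h(A-a)\frac{\partial S(\pi(A|X),t)}{\partial\pi}-\int K_h(a_0-a)\frac{\partial S(\pi(a_0|X),t)}{\partial\pi}\pi(a_0|X)\,da_0 ;$$ assume that both have finite variance. Let $Z_1,Z_2,\dots$ be i.i.d. from $P$, and let $\widehat\pi=\widehat\pi_n$, $\widehat\mu=\widehat\mu_n$ be (jointly measurable) estimators computed from data $D_n$ independent of $(Z_i)_i$ (for example, another sample of size $n$). Let $\widehat\varphi_h^{\rm num},\widehat\varphi_h^{\rm den}$ be the above functions with $(\pi,\mu)$ replaced by $(\widehat\pi,\widehat\mu)$, and $$\widehat\psi_h(a;t)=\frac{n^{-1}\sum_{i=1}^n\widehat\varphi_h^{\rm num}(Z_i)}{n^{-1}\sum_{i=1}^n\widehat\varphi_h^{\rm den}(Z_i)} .$$ Regularity. The four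 integrals over $(x,a_0)$ occurring in the estimands and in the EIFs converge absolutely for $(\pi,\mu)$. Moreover there are a measure $\nu$ on the space of pairs $(x,a_0)$ and a constant $C<\infty$ such that, for all large $n$, almost surely: these integrals converge absolutely for $(\widehat\pi,\widehat\mu)$; $\widehat\pi(a_0|x)>0$ for almost all $(x,a_0)$ with $K_h(a_0-a)\ne0$; and $$|K_h(a_0-a)|\left\{1+|\mu(x,a_0)|+\left|\frac{S(\widehat\pi(a_0|x),t)}{\widehat\pi(a_0|x)}\right|\right\}da_0\,dP(x)\;\le\;C\,d\nu(x,a_0).$$ Write $\|\widehat\pi-\pi\|$ and $\|\widehat\mu-\mu\|$ for $L_2(\nu)$ norms of functions of $(x,a_0)$; when the last condition holds for $\nu$ the law of $(X,A)$, these may be taken to be the $L_2(P)$ norms of $\widehat\pi(A|X)-\pi(A|X)$ and $\widehat\mu(X,A)-\mu(X,A)$. For the EIFs, $\|\cdot\|$ is the $L_2(P)$ norm, with $\widehat\pi,\widehat\mu$ held fixed. If $$\big(\|\widehat\pi-\pi\|+\|\widehat\mu-\mu\|\big)\|\widehat\pi-\pi\|=o_P(n^{-1/2}),\qquad \|\widehat\varphi_h^{\rm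 num}-\varphi_h^{\rm num}\|=o_P(1),\qquad \|\widehat\varphi_h^{\rm den}-\varphi_h^{\rm den}\|=o_P(1),$$ then $$\sqrt n\,\big(\widehat\psi_h(a;t)-\psi_h(a;t)\big)\to N\!\left(0,\ \operatorname{Var}\left\{\frac{\varphi_h^{\rm num}(a;t)-\psi_h(a;t)\,\varphi_h^{\rm den}(a;t)}{\psi_h^{\rm den}(a;t)}\right\}\right)\quad\text{in distribution.}$$ -/

import Mathlib

open MeasureTheory ProbabilityTheory Filter Topology
open scoped ENNReal NNReal

noncomputable section

/-- An observation `Z = (X, A, Y)`: covariates, continuous treatment, outcome. -/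
abbrev Obs (𝒳 : Type*) := 𝒳 × ℝ × ℝ

/-- The covariate-treatment part `(X, A)` of an observation. -/
def covTreat {𝒳 : Type*} (z : Obs 𝒳) : 𝒳 × ℝ := (z.1, z.2.1)

/-- The kernel with bandwidth `h`: `K_h(u) = K(u / h) / h`. -/
def scaledKernel (K : ℝ → ℝ) (h : ℝ) (u : ℝ) : ℝ := K (u / h) / h

/-- `π(a | x)` is a (jointly measurable) conditional density of `A` given `X = x` under `P`:
the law of `(X, A)` is `π(a | x) da dP(x)`. -/
structure IsPropensityScore {𝒳 : Type*} [MeasurableSpace 𝒳] (P : Measure (Obs 𝒳))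
    (π : 𝒳 → ℝ → ℝ) : Prop where
  measurable : Measurable (Function.uncurry π)
  nonneg : ∀ x a, 0 ≤ π x a
  map_eq : P.map covTreat =
    (P.fst.prod volume).withDensity (fun v => ENNReal.ofReal (π v.1 v.2))

/-- `μ(x, a)` is a (jointly measurable) version of `E[Y | X = x, A = a]` under `P`. -/
structure IsOutcomeRegression {𝒳 : Type*} [MeasurableSpace 𝒳] (P : Measure (Obs 𝒳))
    (μ : 𝒳 → ℝ → ℝ) : Prop where
  measurable : Measurable (Function.uncurry μ)
  integrable : Integrable (fun z : Obs 𝒳 => z.2.2) P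
  condExp_eq : (fun z : Obs 𝒳 => μ z.1 z.2.1) =ᵐ[P]
    P[(fun z : Obs 𝒳 => z.2.2) | MeasurableSpace.comap covTreat inferInstance]

section Functionals

variable {𝒳 : Type*}

/-- The derivative `∂S(p, t)/∂p` of the smoothed indicator in its first argument. -/
def dS (S : ℝ → ℝ → ℝ) (p t : ℝ) : ℝ := deriv (fun q => S q t) p

/-- The numerator estimand `∫ ∫ k(a₀ - a) S(π(a₀|x), t) μ(x, a₀) da₀ dP(x)`. -/
def psiNum [MeasurableSpace 𝒳] (P : Measure (Obs 𝒳)) (k : ℝ → ℝ) (S : ℝ → ℝ → ℝ) (a t : ℝ)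
    (π μ : 𝒳 → ℝ → ℝ) : ℝ :=
  ∫ x, (∫ a₀, k (a₀ - a) * S (π x a₀) t * μ x a₀) ∂P.fst

/-- The denominator estimand `∫ ∫ k(a₀ - a) S(π(a₀|x), t) da₀ dP(x)`. -/
def psiDen [MeasurableSpace 𝒳] (P : Measure (Obs 𝒳)) (k : ℝ → ℝ) (S : ℝ → ℝ → ℝ) (a t : ℝ)
    (π : 𝒳 → ℝ → ℝ) : ℝ :=
  ∫ x, (∫ a₀, k (a₀ - a) * S (π x a₀) t) ∂P.fst

/-- The smoothed trimmed average treatment effect. -/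
def psi [MeasurableSpace 𝒳] (P : Measure (Obs 𝒳)) (k : ℝ → ℝ) (S : ℝ → ℝ → ℝ) (a t : ℝ)
    (π μ : 𝒳 → ℝ → ℝ) : ℝ :=
  psiNum P k S a t π μ / psiDen P k S a t π

/-- The uncentered efficient influence function of the numerator at `z = (X, A, Y)`. -/
def eifNum (k : ℝ → ℝ) (S : ℝ → ℝ → ℝ) (a t : ℝ) (π μ : 𝒳 → ℝ → ℝ) (z : Obs 𝒳) : ℝ :=
  k (z.2.1 - a) * ((z.2.2 - μ z.1 z.2.1) * S (π z.1 z.2.1) t / π z.1 z.2.1)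
  + (∫ a₀, k (a₀ - a) * S (π z.1 a₀) t * μ z.1 a₀)
  + k (z.2.1 - a) * μ z.1 z.2.1 * dS S (π z.1 z.2.1) t
  - (∫ a₀, k (a₀ - a) * μ z.1 a₀ * dS S (π z.1 a₀) t * π z.1 a₀)

/-- The uncentered efficient influence function of the denominator at `z = (X, A, Y)`. -/
def eifDen (k : ℝ → ℝ) (S : ℝ → ℝ → ℝ) (a t : ℝ) (π : 𝒳 → ℝ → ℝ) (z : Obs 𝒳) : ℝ :=
  (∫ a₀, k (a₀ - a) * S (π z.1 a₀) t)
  + k (z.2.1 - a) * dS S (π z.1 z.2.1) t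
  - (∫ a₀, k (a₀ - a) * dS S (π z.1 a₀) t * π z.1 a₀)

/-- The integrals over `(x, a₀)` in the estimands and in the influence functions converge
absolutely (otherwise the Bochner integrals above carry junk values). -/
structure TermsIntegrable [MeasurableSpace 𝒳] (P : Measure (Obs 𝒳)) (k : ℝ → ℝ)
    (S : ℝ → ℝ → ℝ) (a t : ℝ) (π μ : 𝒳 → ℝ → ℝ) : Prop where
  num : Integrable (fun v : 𝒳 × ℝ => k (v.2 - a) * S (π v.1 v.2) t * μ v.1 v.2)
    (P.fst.prod volume)
  num_deriv : Integrable
    (fun v : 𝒳 × ℝ => k (v.2 - a) * μ v.1 v.2 * dS S (π v.1 v.2) t * π v.1 v.2)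
    (P.fst.prod volume)
  den : Integrable (fun v : 𝒳 × ℝ => k (v.2 - a) * S (π v.1 v.2) t) (P.fst.prod volume)
  den_deriv : Integrable (fun v : 𝒳 × ℝ => k (v.2 - a) * dS S (π v.1 v.2) t * π v.1 v.2)
    (P.fst.prod volume)

/-- The sample average `n⁻¹ ∑_{i < n} f(Z_i)`. -/
def sampleMean (n : ℕ) (z : ℕ → Obs 𝒳) (f : Obs 𝒳 → ℝ) : ℝ :=
  (n : ℝ)⁻¹ * ∑ i ∈ Finset.range n, f (z i)

/-- The ratio of the two one-step estimators, from the sample `z 0, …, z (n - 1)` and the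
nuisance estimates `π`, `μ`. -/
def psiHat (k : ℝ → ℝ) (S : ℝ → ℝ → ℝ) (a t : ℝ) (π μ : 𝒳 → ℝ → ℝ) (n : ℕ)
    (z : ℕ → Obs 𝒳) : ℝ :=
  sampleMean n z (eifNum k S a t π μ) / sampleMean n z (eifDen k S a t π)

/-- The `L₂(ν)` distance of two functions of `(x, a)`; for `ν` the law of `(X, A)` under `P`
this is the `L₂(P)` distance of `f(X, A)` and `g(X, A)`. -/
def nuisanceDist [MeasurableSpace 𝒳] (ν : Measure (𝒳 × ℝ)) (f g : 𝒳 → ℝ → ℝ) : ℝ≥0∞ :=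
  eLpNorm (fun v : 𝒳 × ℝ => f v.1 v.2 - g v.1 v.2) 2 ν

end Functionals

/-- `V_n = o_P(r_n)` for nonnegative extended-real random quantities `V_n`. -/
def IsLittleOP {Ω : Type*} [MeasurableSpace Ω] (Pr : Measure Ω) (V : ℕ → Ω → ℝ≥0∞)
    (r : ℕ → ℝ) : Prop :=
  ∀ ε : ℝ, 0 < ε → Tendsto (fun n => Pr {ω | ENNReal.ofReal (ε * r n) < V n ω}) atTop (𝓝 0)

end

/-! Write `Pₙ` for the sample average, `φ` for either influence function and `φ̂` for its estimate.
Then `Pₙφ̂ - Pₙφ = (Pₙ - P)(φ̂ - φ) + P(φ̂ - φ)`, and both terms are `o_P(n^{-1/2})`.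

The first term is an empirical process at a random function that is independent of the sample. With
the auxiliary data frozen, Chebyshev bounds it through `‖φ̂ - φ‖`, which tends to zero
(`measure_empiricalProcess_indep_ge_le`).

The second term is the bias, because `Pφ` equals the estimand. Conditioning on `(X, A)` replaces `Y`
by `μ(X, A)` and turns the bias into a single integral over `(x, a₀)` (`integral_eifNum`,
`integral_eifDen`). Its integrand is an exact sum of second-order terms: products of the two
nuisance errors, and a Taylor remainder of `S` that is quadratic in `π̂ - π` (`abs_num_bias_le`,
`abs_den_bias_le`). Every term carries a factor `π̂ - π`, so Cauchy–Schwarz in `L₂(ν)` yields the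
product in the rate condition (`enorm_integral_le_nuisanceDist`).

Numerator and denominator are thus asymptotically linear, and `tendstoInDistribution_ratio`
concludes by the central limit theorem and Slutsky. -/

/-! ### Expectations of functions affine in the outcome. -/

/-- Only the sum `f * Y + g` is known to be integrable, so linearity and pull-out do not apply
directly. Multiplying by the positive bounded weight `(1 + |f| + |g|)⁻¹` makes both summands
integrable; the weight is `m`-measurable, so it comes out of the conditional expectation and cancels
at the end. -/
theorem condExp_mul_add {Ω : Type*} {m m₀ : MeasurableSpace Ω} (hm : m ≤ m₀) {P : Measure Ω}
    [IsFiniteMeasure P] {f g Y : Ω → ℝ} (hf : StronglyMeasurable[m] f)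
    (hg : StronglyMeasurable[m] g) (hY : Integrable Y P)
    (hH : Integrable (fun z => f z * Y z + g z) P) :
    P[fun z => f z * Y z + g z | m] =ᵐ[P] fun z => f z * P[Y | m] z + g z := by
  set b : Ω → ℝ := fun z => (1 + |f z| + |g z|)⁻¹ with hb
  have hpos : ∀ z, 0 < 1 + |f z| + |g z| := fun z => by positivity
  have hbm : StronglyMeasurable[m] b := by
    have h : Measurable fun v : ℝ × ℝ => (1 + |v.1| + |v.2|)⁻¹ := by fun_prop
    exact (h.comp (hf.measurable.prodMk hg.measurable)).stronglyMeasurable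
  have hb1 : ∀ z, ‖b z‖ ≤ 1 := fun z => by
    rw [Real.norm_of_nonneg (inv_pos.2 (hpos z)).le]
    exact inv_le_one_of_one_le₀ (by linarith [abs_nonneg (f z), abs_nonneg (g z)])
  have hbf : ∀ z, ‖(b * f) z‖ ≤ 1 := fun z => by
    rw [Pi.mul_apply, norm_mul, Real.norm_of_nonneg (inv_pos.2 (hpos z)).le, Real.norm_eq_abs,
      inv_mul_le_one₀ (hpos z)]
    linarith [abs_nonneg (g z)]
  have hbg : ∀ z, ‖(b * g) z‖ ≤ 1 := fun z => by
    rw [Pi.mul_apply, norm_mul, Real.norm_of_nonneg (inv_pos.2 (hpos z)).le, Real.norm_eq_abs,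
      inv_mul_le_one₀ (hpos z)]
    linarith [abs_nonneg (f z)]
  have hbgi : Integrable (b * g) P :=
    Integrable.of_bound ((hbm.mul hg).mono hm).aestronglyMeasurable 1 (.of_forall hbg)
  have hbfY : Integrable ((b * f) * Y) P :=
    hY.bdd_mul ((hbm.mul hf).mono hm).aestronglyMeasurable (.of_forall hbf)
  have e1 := condExp_stronglyMeasurable_mul_of_bound hm hbm hH 1 (.of_forall hb1)
  have e2 := condExp_stronglyMeasurable_mul_of_bound hm (hbm.mul hf) hY 1 (.of_forall hbf)
  have e3 := condExp_of_stronglyMeasurable hm (hbm.mul hg) hbgi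
  have e4 := condExp_add hbfY hbgi m
  have e5 : b * (fun z => f z * Y z + g z) = b * f * Y + b * g := by
    ext z; simp only [Pi.mul_apply, Pi.add_apply]; ring
  rw [e5] at e1
  rw [e3] at e4
  filter_upwards [e1, e2, e4] with z h1 h2 h4
  rw [h1, Pi.add_apply, h2] at h4
  simp only [Pi.mul_apply] at h4
  have hbz : b z ≠ 0 := (inv_pos.2 (hpos z)).ne'
  apply mul_left_cancel₀ hbz
  rw [h4]; ring

section Means

variable {𝒳 : Type*} [MeasurableSpace 𝒳] {P : Measure (Obs 𝒳)}
  {π μ : 𝒳 → ℝ → ℝ}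

theorem measurable_covTreat : Measurable (covTreat : Obs 𝒳 → 𝒳 × ℝ) := by
  unfold covTreat; fun_prop

theorem IsPropensityScore.integrable_comp_iff (hπ : IsPropensityScore P π) {f : 𝒳 × ℝ → ℝ}
    (hf : Measurable f) : Integrable (fun z => f (covTreat z)) P ↔
      Integrable (fun v => f v * π v.1 v.2) (P.fst.prod volume) := by
  have hm : Measurable fun v : 𝒳 × ℝ => π v.1 v.2 := hπ.measurable
  rw [← Function.comp_def, ← integrable_map_measure hf.aestronglyMeasurable
    measurable_covTreat.aemeasurable, hπ.map_eq,
    integrable_withDensity_iff_integrable_smul' hm.ennreal_ofReal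
      (.of_forall fun _ => ENNReal.ofReal_lt_top)]
  simp [ENNReal.toReal_ofReal, hπ.nonneg, mul_comm]

theorem IsPropensityScore.integral_comp (hπ : IsPropensityScore P π) {f : 𝒳 × ℝ → ℝ}
    (hf : Measurable f) : ∫ z, f (covTreat z) ∂P =
      ∫ v, f v * π v.1 v.2 ∂(P.fst.prod volume) := by
  have hm : Measurable fun v : 𝒳 × ℝ => π v.1 v.2 := hπ.measurable
  rw [← integral_map measurable_covTreat.aemeasurable hf.aestronglyMeasurable, hπ.map_eq,
    integral_withDensity_eq_integral_toReal_smul hm.ennreal_ofReal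
      (.of_forall fun _ => ENNReal.ofReal_lt_top)]
  simp [ENNReal.toReal_ofReal, hπ.nonneg, mul_comm]

/-- The tower property replaces `Y` by `μ(X, A)`, and the propensity score then serves as the
density of `(X, A)` with respect to `da dP(x)`. -/
theorem integral_outcome_affine [IsProbabilityMeasure P] (hπ : IsPropensityScore P π) (hμ : IsOutcomeRegression P μ)
    {f g : 𝒳 × ℝ → ℝ} (hf : Measurable f) (hg : Measurable g)
    (hH : Integrable (fun z : Obs 𝒳 => f (covTreat z) * z.2.2 + g (covTreat z)) P) :
    Integrable (fun v => (f v * μ v.1 v.2 + g v) * π v.1 v.2) (P.fst.prod volume) ∧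
    ∫ z : Obs 𝒳, f (covTreat z) * z.2.2 + g (covTreat z) ∂P =
      ∫ v, (f v * μ v.1 v.2 + g v) * π v.1 v.2 ∂(P.fst.prod volume) := by
  have hm : MeasurableSpace.comap (covTreat : Obs 𝒳 → 𝒳 × ℝ) inferInstance ≤
      (inferInstance : MeasurableSpace (Obs 𝒳)) :=
    measurable_covTreat.comap_le
  have hc : Measurable[MeasurableSpace.comap covTreat inferInstance]
      (covTreat : Obs 𝒳 → 𝒳 × ℝ) := comap_measurable _
  have e := condExp_mul_add hm (hf.comp hc).stronglyMeasurable (hg.comp hc).stronglyMeasurable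
    hμ.integrable hH
  have e' : P[fun z : Obs 𝒳 => f (covTreat z) * z.2.2 + g (covTreat z) |
      MeasurableSpace.comap covTreat inferInstance] =ᵐ[P]
      fun z => (fun v : 𝒳 × ℝ => f v * μ v.1 v.2 + g v) (covTreat z) := by
    filter_upwards [e, hμ.condExp_eq] with z h1 h2
    rw [← h2] at h1
    exact h1
  have hμm : Measurable fun v : 𝒳 × ℝ => μ v.1 v.2 := hμ.measurable
  have hmeas : Measurable (fun v : 𝒳 × ℝ => f v * μ v.1 v.2 + g v) := by fun_prop
  refine ⟨(hπ.integrable_comp_iff hmeas).1 (integrable_condExp.congr e'), ?_⟩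
  rw [← hπ.integral_comp hmeas, ← integral_congr_ae e', integral_condExp hm]

theorem integrable_covariate_integral [IsProbabilityMeasure P] {f : 𝒳 × ℝ → ℝ}
    (hf : Integrable f (P.fst.prod volume)) :
    Integrable (fun z : Obs 𝒳 => ∫ a₀, f (z.1, a₀)) P :=
  hf.integral_prod_left.comp_measurable measurable_fst

theorem integral_covariate_integral [IsProbabilityMeasure P] {f : 𝒳 × ℝ → ℝ}
    (hf : Integrable f (P.fst.prod volume)) :
    ∫ z : Obs 𝒳, (∫ a₀, f (z.1, a₀)) ∂P = ∫ v, f v ∂(P.fst.prod volume) := by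
  rw [integral_prod f hf]
  exact (integral_map measurable_fst.aemeasurable
    hf.integral_prod_left.aestronglyMeasurable).symm

end Means

/-! ### Pointwise second-order expansion of the bias. -/

section Smoothing

variable {S : ℝ → ℝ → ℝ} {t : ℝ} {L : ℝ≥0}

/-- Mean value inequality for `x ↦ S x t - dS S q t * x`, whose derivative is at most `L * |q - p|`
on the segment by the Lipschitz bound. The expansion is around `q`, the estimate, since the
influence function is evaluated there. -/
theorem abs_taylor_le (hS : Differentiable ℝ (fun p => S p t))
    (hS₂ : LipschitzWith L (fun p => dS S p t)) (p q : ℝ) :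
    |S q t - S p t + dS S q t * (p - q)| ≤ L * |q - p| ^ 2 := by
  have hd : ∀ x ∈ Set.uIcc p q, HasDerivWithinAt (fun x => S x t - dS S q t * x)
      (dS S x t - dS S q t) (Set.uIcc p q) x := fun x _ => by
    simpa using! ((hS x).hasDerivAt.sub
      ((hasDerivAt_id x).const_mul (dS S q t))).hasDerivWithinAt
  have hb : ∀ x ∈ Set.uIcc p q, ‖dS S x t - dS S q t‖ ≤ L * |q - p| := fun x hx => by
    have := hS₂.dist_le_mul x q
    rw [← dist_eq_norm]
    refine this.trans (mul_le_mul_of_nonneg_left ?_ L.2)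
    rw [Real.dist_eq]
    rw [abs_sub_comm x q]
    exact Set.abs_sub_right_of_mem_uIcc hx
  have := (convex_uIcc p q).norm_image_sub_le_of_norm_hasDerivWithin_le hd hb
    Set.left_mem_uIcc Set.right_mem_uIcc
  rw [Real.norm_eq_abs, Real.norm_eq_abs] at this
  calc _ = |S q t - dS S q t * q - (S p t - dS S q t * p)| := by ring_nf
    _ ≤ _ := this
    _ = _ := by ring

/-- Here `p, m` are the true nuisances and `q, n` the estimates. First-order terms cancel
identically, as the equation `e` in the proof shows. The weight on the right involves only `μ` and
`S(π̂)/π̂`, never `μ̂` or `1/π`. -/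
theorem abs_num_bias_le (hS : Differentiable ℝ (fun p => S p t)) (hS₁ : ∀ p, |dS S p t| ≤ L)
    (hS₂ : LipschitzWith L (fun p => dS S p t)) {k p q m n : ℝ} (hq : k ≠ 0 → 0 < q) :
    |(k * S q t / q * m + (-(k * S q t / q * n) + k * n * dS S q t)) * p + k * S q t * n
      - k * n * dS S q t * q - k * S p t * m|
    ≤ (|k| * (1 + |m| + |S q t / q|)) * ((1 + L) * ((|q - p| + |n - m|) * |q - p|)) := by
  rcases eq_or_ne k 0 with rfl | hk
  · simp
  have hq0 : q ≠ 0 := (hq hk).ne'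
  have hL : (0 : ℝ) ≤ L := L.2
  have e : (k * S q t / q * m + (-(k * S q t / q * n) + k * n * dS S q t)) * p + k * S q t * n
      - k * n * dS S q t * q - k * S p t * m =
      k * ((S q t / q) * ((n - m) * (q - p)) + m * (S q t - S p t + dS S q t * (p - q))
        + dS S q t * ((n - m) * (p - q))) := by
    field_simp; ring
  rw [e, abs_mul, mul_assoc]
  refine mul_le_mul_of_nonneg_left ?_ (abs_nonneg k)
  have h1 : |(S q t / q) * ((n - m) * (q - p))| = |S q t / q| * (|n - m| * |q - p|) := by
    simp only [abs_mul]
  have h2 : |m * (S q t - S p t + dS S q t * (p - q))| ≤ |m| * (L * |q - p| ^ 2) := by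
    rw [abs_mul]
    exact mul_le_mul_of_nonneg_left (abs_taylor_le hS hS₂ p q) (abs_nonneg m)
  have h3 : |dS S q t * ((n - m) * (p - q))| ≤ L * (|n - m| * |q - p|) := by
    rw [abs_mul, abs_mul, abs_sub_comm p q]
    exact mul_le_mul_of_nonneg_right (hS₁ q) (by positivity)
  refine (abs_add_three _ _ _).trans ?_
  rw [h1]
  calc _ ≤ |S q t / q| * (|n - m| * |q - p|) + |m| * (L * |q - p| ^ 2)
        + L * (|n - m| * |q - p|) := by gcongr
    -- The added bracket consists of the terms missing from the expansion of the target product, all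
    -- nonnegative.
    _ ≤ |S q t / q| * (|n - m| * |q - p|) + |m| * (L * |q - p| ^ 2)
        + L * (|n - m| * |q - p|) + ((1 + |m|) * (|n - m| * |q - p|) + |m| * L * (|n - m| * |q - p|)
        + |S q t / q| * L * (|n - m| * |q - p|) + (1 + |m| + |S q t / q|) * |q - p| ^ 2
        + (1 + |S q t / q|) * L * |q - p| ^ 2) := le_add_of_nonneg_right (by positivity)
    _ = _ := by ring

/-- The bias is just a Taylor remainder. The bound is deliberately loose, with free `m` and `n`, so
that the same weight and rate serve numerator and denominator. -/
theorem abs_den_bias_le (hS : Differentiable ℝ (fun p => S p t))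
    (hS₂ : LipschitzWith L (fun p => dS S p t)) {k p q m n : ℝ} :
    |k * dS S q t * p + k * S q t - k * dS S q t * q - k * S p t|
    ≤ (|k| * (1 + |m| + |S q t / q|)) * ((1 + L) * ((|q - p| + |n - m|) * |q - p|)) := by
  have e : k * dS S q t * p + k * S q t - k * dS S q t * q - k * S p t =
      k * (S q t - S p t + dS S q t * (p - q)) := by ring
  have hL : (0 : ℝ) ≤ L := L.2
  rw [e, abs_mul]
  calc _ ≤ |k| * (L * |q - p| ^ 2) := by gcongr; exact abs_taylor_le hS hS₂ p q
    _ = (|k| * 1) * (L * (|q - p| * |q - p|)) := by ring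
    _ ≤ _ := by
      gcongr
      · linarith [abs_nonneg m, abs_nonneg (S q t / q)]
      · linarith
      · linarith [abs_nonneg (n - m)]

end Smoothing

/-! ### Means of the influence functions and bounds on their bias. -/

section Bias

variable {𝒳 : Type*} [MeasurableSpace 𝒳] {P : Measure (Obs 𝒳)} [IsProbabilityMeasure P]
  {π μ : 𝒳 → ℝ → ℝ} {k : ℝ → ℝ} {S : ℝ → ℝ → ℝ} {a t : ℝ} {p m : 𝒳 → ℝ → ℝ}

theorem integral_add_sub {α : Type*} [MeasurableSpace α] {ρ : Measure α} {f g h : α → ℝ}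
    (hf : Integrable f ρ) (hg : Integrable g ρ) (hh : Integrable h ρ) :
    ∫ x, f x + g x - h x ∂ρ = ∫ x, f x ∂ρ + ∫ x, g x ∂ρ - ∫ x, h x ∂ρ := by
  rw [← integral_add hf hg]
  exact integral_sub (hf.add hg) hh

theorem integral_eifNum (hπ : IsPropensityScore P π) (hμ : IsOutcomeRegression P μ)
    (hk : Measurable k) (hS : Measurable fun q => S q t) (hdS : Measurable fun q => dS S q t)
    (hp : Measurable (Function.uncurry p)) (hm : Measurable (Function.uncurry m))
    (hint : TermsIntegrable P k S a t p m) (hφ : Integrable (eifNum k S a t p m) P) :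
    Integrable (fun v : 𝒳 × ℝ =>
      (k (v.2 - a) * S (p v.1 v.2) t / p v.1 v.2 * μ v.1 v.2
        + (-(k (v.2 - a) * S (p v.1 v.2) t / p v.1 v.2 * m v.1 v.2)
          + k (v.2 - a) * m v.1 v.2 * dS S (p v.1 v.2) t)) * π v.1 v.2
        + k (v.2 - a) * S (p v.1 v.2) t * m v.1 v.2
        - k (v.2 - a) * m v.1 v.2 * dS S (p v.1 v.2) t * p v.1 v.2) (P.fst.prod volume) ∧
    ∫ z, eifNum k S a t p m z ∂P = ∫ v : 𝒳 × ℝ,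
      (k (v.2 - a) * S (p v.1 v.2) t / p v.1 v.2 * μ v.1 v.2
        + (-(k (v.2 - a) * S (p v.1 v.2) t / p v.1 v.2 * m v.1 v.2)
          + k (v.2 - a) * m v.1 v.2 * dS S (p v.1 v.2) t)) * π v.1 v.2
        + k (v.2 - a) * S (p v.1 v.2) t * m v.1 v.2
        - k (v.2 - a) * m v.1 v.2 * dS S (p v.1 v.2) t * p v.1 v.2 ∂(P.fst.prod volume) := by
  have hp' : Measurable fun v : 𝒳 × ℝ => p v.1 v.2 := hp
  have hm' : Measurable fun v : 𝒳 × ℝ => m v.1 v.2 := hm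
  have hS' : Measurable fun v : 𝒳 × ℝ => S (p v.1 v.2) t := hS.comp hp'
  have hdS' : Measurable fun v : 𝒳 × ℝ => dS S (p v.1 v.2) t := hdS.comp hp'
  have hk' : Measurable fun v : 𝒳 × ℝ => k (v.2 - a) := by fun_prop
  set f : 𝒳 × ℝ → ℝ := fun v => k (v.2 - a) * S (p v.1 v.2) t / p v.1 v.2 with hf
  set g : 𝒳 × ℝ → ℝ := fun v => -(k (v.2 - a) * S (p v.1 v.2) t / p v.1 v.2 * m v.1 v.2)
          + k (v.2 - a) * m v.1 v.2 * dS S (p v.1 v.2) t with hg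
  have hfm : Measurable f := by fun_prop
  have hgm : Measurable g := by fun_prop
  have i2 := integrable_covariate_integral hint.num
  have i4 := integrable_covariate_integral hint.num_deriv
  have e : eifNum k S a t p m = fun z => (f (covTreat z) * z.2.2 + g (covTreat z))
      + (∫ a₀, k (a₀ - a) * S (p z.1 a₀) t * m z.1 a₀)
      - ∫ a₀, k (a₀ - a) * m z.1 a₀ * dS S (p z.1 a₀) t * p z.1 a₀ := by
    ext z
    simp only [eifNum, hf, hg, covTreat]
    ring
  -- The part affine in `Y` is integrable as the difference of the whole influence function and its
  -- two inner integrals; its own summands need not be.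
  have hH : Integrable (fun z : Obs 𝒳 => f (covTreat z) * z.2.2 + g (covTreat z)) P := by
    refine ((hφ.sub i2).add i4).congr (.of_forall fun z => ?_)
    simp only [e, Pi.add_apply, Pi.sub_apply]
    ring
  obtain ⟨h1, h2⟩ := integral_outcome_affine hπ hμ hfm hgm hH
  refine ⟨(h1.add hint.num).sub hint.num_deriv, ?_⟩
  rw [e]
  refine (integral_add_sub hH i2 i4).trans ?_
  rw [h2, integral_covariate_integral hint.num, integral_covariate_integral hint.num_deriv]
  exact (integral_add_sub h1 hint.num hint.num_deriv).symm

theorem integral_eifDen (hπ : IsPropensityScore P π)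
    (hk : Measurable k) (hdS : Measurable fun q => dS S q t)
    (hp : Measurable (Function.uncurry p))
    (hint : TermsIntegrable P k S a t p m) (hφ : Integrable (eifDen k S a t p) P) :
    Integrable (fun v : 𝒳 × ℝ => k (v.2 - a) * dS S (p v.1 v.2) t * π v.1 v.2
        + k (v.2 - a) * S (p v.1 v.2) t
        - k (v.2 - a) * dS S (p v.1 v.2) t * p v.1 v.2) (P.fst.prod volume) ∧
    ∫ z, eifDen k S a t p z ∂P = ∫ v : 𝒳 × ℝ, k (v.2 - a) * dS S (p v.1 v.2) t * π v.1 v.2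
        + k (v.2 - a) * S (p v.1 v.2) t
        - k (v.2 - a) * dS S (p v.1 v.2) t * p v.1 v.2 ∂(P.fst.prod volume) := by
  have hp' : Measurable fun v : 𝒳 × ℝ => p v.1 v.2 := hp
  have hdS' : Measurable fun v : 𝒳 × ℝ => dS S (p v.1 v.2) t := hdS.comp hp'
  set g : 𝒳 × ℝ → ℝ := fun v => k (v.2 - a) * dS S (p v.1 v.2) t with hg
  have hgm : Measurable g := by fun_prop
  have i2 := integrable_covariate_integral hint.den
  have i4 := integrable_covariate_integral hint.den_deriv
  have e : eifDen k S a t p = fun z => g (covTreat z)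
      + (∫ a₀, k (a₀ - a) * S (p z.1 a₀) t)
      - ∫ a₀, k (a₀ - a) * dS S (p z.1 a₀) t * p z.1 a₀ := by
    ext z
    simp only [eifDen, hg, covTreat]
    ring
  have hH : Integrable (fun z : Obs 𝒳 => g (covTreat z)) P := by
    refine ((hφ.sub i2).add i4).congr (.of_forall fun z => ?_)
    simp only [e, Pi.add_apply, Pi.sub_apply]
    ring
  have h1 := (hπ.integrable_comp_iff hgm).1 hH
  refine ⟨(h1.add hint.den).sub hint.den_deriv, ?_⟩
  rw [e]
  refine (integral_add_sub hH i2 i4).trans ?_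
  rw [hπ.integral_comp hgm, integral_covariate_integral hint.den,
    integral_covariate_integral hint.den_deriv]
  exact (integral_add_sub h1 hint.den hint.den_deriv).symm

/-- At the true nuisances the residual term has mean zero and the two derivative terms cancel. The
cancellation is purely algebraic, so zeros of `π` do no harm. -/
theorem integral_eifNum_self (hπ : IsPropensityScore P π) (hμ : IsOutcomeRegression P μ)
    (hk : Measurable k) (hS : Measurable fun q => S q t) (hdS : Measurable fun q => dS S q t)
    (hint : TermsIntegrable P k S a t π μ) (hφ : Integrable (eifNum k S a t π μ) P) :
    ∫ z, eifNum k S a t π μ z ∂P = psiNum P k S a t π μ := by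
  rw [(integral_eifNum hπ hμ hk hS hdS hπ.measurable hμ.measurable hint hφ).2, psiNum,
    ← integral_prod _ hint.num]
  congr 1 with v
  ring

theorem integral_eifDen_self (hπ : IsPropensityScore P π) (hk : Measurable k)
    (hdS : Measurable fun q => dS S q t)
    (hint : TermsIntegrable P k S a t π μ) (hφ : Integrable (eifDen k S a t π) P) :
    ∫ z, eifDen k S a t π z ∂P = psiDen P k S a t π := by
  rw [(integral_eifDen hπ hk hdS hπ.measurable hint hφ).2, psiDen,
    ← integral_prod _ hint.den]
  congr 1 with v
  ring

theorem lintegral_enorm_mul_le_eLpNorm {α : Type*} [MeasurableSpace α] {ν : Measure α}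
    {f g : α → ℝ} (hf : Measurable f) (hg : Measurable g) :
    ∫⁻ x, ‖f x‖ₑ * ‖g x‖ₑ ∂ν ≤ eLpNorm f 2 ν * eLpNorm g 2 ν := by
  have := ENNReal.lintegral_mul_le_Lp_mul_Lq ν Real.HolderConjugate.two_two
    hf.enorm.aemeasurable hg.enorm.aemeasurable
  simpa [eLpNorm_eq_lintegral_rpow_enorm_toReal] using this

/-- A weighted integral dominated by the nuisance errors is controlled by their `L₂` distances. -/
theorem enorm_integral_le_nuisanceDist {J w : 𝒳 × ℝ → ℝ} {ν : Measure (𝒳 × ℝ)} {C L : ℝ≥0}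
    {ρ : Measure (𝒳 × ℝ)}
    (hπ : Measurable (Function.uncurry π)) (hμ : Measurable (Function.uncurry μ))
    (hp : Measurable (Function.uncurry p)) (hm : Measurable (Function.uncurry m))
    (hw : Measurable w) (hw0 : ∀ v, 0 ≤ w v)
    (hν : ρ.withDensity (fun v => ENNReal.ofReal (w v)) ≤ C • ν)
    (hJ : ∀ᵐ v ∂ρ, |J v| ≤ w v * ((1 + L) *
      ((|p v.1 v.2 - π v.1 v.2| + |m v.1 v.2 - μ v.1 v.2|) * |p v.1 v.2 - π v.1 v.2|))) :
    ‖∫ v, J v ∂ρ‖ₑ ≤ C * (1 + L) *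
      ((nuisanceDist ν p π + nuisanceDist ν m μ) * nuisanceDist ν p π) := by
  have hd : Measurable fun v : 𝒳 × ℝ => p v.1 v.2 - π v.1 v.2 := hp.sub hπ
  have he : Measurable fun v : 𝒳 × ℝ => m v.1 v.2 - μ v.1 v.2 := hm.sub hμ
  set d : 𝒳 × ℝ → ℝ := fun v => p v.1 v.2 - π v.1 v.2 with hd_def
  set e : 𝒳 × ℝ → ℝ := fun v => m v.1 v.2 - μ v.1 v.2 with he_def
  set F : 𝒳 × ℝ → ℝ≥0∞ := fun v => (1 + L) * ((‖d v‖ₑ + ‖e v‖ₑ) * ‖d v‖ₑ) with hF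
  have hFm : Measurable F := by fun_prop
  calc ‖∫ v, J v ∂ρ‖ₑ ≤ ∫⁻ v, ‖J v‖ₑ ∂ρ := enorm_integral_le_lintegral_enorm _
    _ ≤ ∫⁻ v, ENNReal.ofReal (w v) * F v ∂ρ := by
      refine lintegral_mono_ae (hJ.mono fun v hv => ?_)
      rw [Real.enorm_eq_ofReal_abs]
      refine (ENNReal.ofReal_le_ofReal hv).trans (le_of_eq ?_)
      rw [ENNReal.ofReal_mul (hw0 v), ENNReal.ofReal_mul (by positivity),
        ENNReal.ofReal_mul (by positivity), ENNReal.ofReal_add (abs_nonneg _) (abs_nonneg _),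
        ENNReal.ofReal_add zero_le_one L.coe_nonneg]
      simp [hF, Real.enorm_eq_ofReal_abs, hd_def, he_def]
    _ = ∫⁻ v, F v ∂(ρ.withDensity fun v => ENNReal.ofReal (w v)) :=
      (lintegral_withDensity_eq_lintegral_mul _ hw.ennreal_ofReal hFm).symm
    -- Domination of the trimmed weight by `ν` enters here. Working in `ℝ≥0∞` removes any need for
    -- finite nuisance errors.
    _ ≤ ∫⁻ v, F v ∂(C • ν) := lintegral_mono' hν le_rfl
    _ = C * ((1 + L) * ((∫⁻ v, ‖d v‖ₑ * ‖d v‖ₑ ∂ν) + ∫⁻ v, ‖e v‖ₑ * ‖d v‖ₑ ∂ν)) := by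
      rw [lintegral_smul_measure, lintegral_const_mul _ (by fun_prop)]
      simp only [add_mul]
      rw [lintegral_add_left (by fun_prop)]
      simp only [ENNReal.smul_def, smul_eq_mul]
    _ ≤ C * ((1 + L) * ((nuisanceDist ν p π * nuisanceDist ν p π)
          + nuisanceDist ν m μ * nuisanceDist ν p π)) := by
      gcongr
      · exact lintegral_enorm_mul_le_eLpNorm hd hd
      · exact lintegral_enorm_mul_le_eLpNorm he hd
    _ = _ := by ring

variable {L C : ℝ≥0} {ν : Measure (𝒳 × ℝ)}

theorem enorm_eifNum_bias_le (hπ : IsPropensityScore P π) (hμ : IsOutcomeRegression P μ)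
    (hk : Measurable k) (hS : Differentiable ℝ (fun p => S p t)) (hS₁ : ∀ p, |dS S p t| ≤ L)
    (hS₂ : LipschitzWith L (fun p => dS S p t)) (hint : TermsIntegrable P k S a t π μ)
    (hp : Measurable (Function.uncurry p)) (hm : Measurable (Function.uncurry m))
    (hinthat : TermsIntegrable P k S a t p m)
    (hpos : ∀ᵐ v ∂(P.fst.prod volume), k (v.2 - a) ≠ 0 → 0 < p v.1 v.2)
    (hν : (P.fst.prod volume).withDensity (fun v => ENNReal.ofReal (|k (v.2 - a)| *
        (1 + |μ v.1 v.2| + |S (p v.1 v.2) t / p v.1 v.2|))) ≤ C • ν)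
    (hφ : Integrable (eifNum k S a t p m) P) :
    ‖∫ z, eifNum k S a t p m z ∂P - psiNum P k S a t π μ‖ₑ ≤ C * (1 + L) *
      ((nuisanceDist ν p π + nuisanceDist ν m μ) * nuisanceDist ν p π) := by
  obtain ⟨h1, h2⟩ := integral_eifNum hπ hμ hk hS.continuous.measurable hS₂.continuous.measurable
    hp hm hinthat hφ
  rw [h2, psiNum, ← integral_prod _ hint.num, ← integral_sub h1 hint.num]
  have hp' : Measurable fun v : 𝒳 × ℝ => p v.1 v.2 := hp
  have hμ' : Measurable fun v : 𝒳 × ℝ => μ v.1 v.2 := hμ.measurable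
  have hS' : Measurable fun v : 𝒳 × ℝ => S (p v.1 v.2) t := hS.continuous.measurable.comp hp'
  have hw : Measurable fun v : 𝒳 × ℝ =>
      |k (v.2 - a)| * (1 + |μ v.1 v.2| + |S (p v.1 v.2) t / p v.1 v.2|) :=
    (hk.comp (measurable_snd.sub_const a)).abs.mul
      ((measurable_const.add hμ'.abs).add (hS'.div hp').abs)
  refine enorm_integral_le_nuisanceDist hπ.measurable hμ.measurable hp hm hw
    (fun v => by positivity) hν ?_
  filter_upwards [hpos] with v hv
  exact abs_num_bias_le hS hS₁ hS₂ hv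

theorem enorm_eifDen_bias_le (hπ : IsPropensityScore P π) (hμ : IsOutcomeRegression P μ)
    (hk : Measurable k) (hS : Differentiable ℝ (fun p => S p t))
    (hS₂ : LipschitzWith L (fun p => dS S p t)) (hint : TermsIntegrable P k S a t π μ)
    (hp : Measurable (Function.uncurry p)) (hm : Measurable (Function.uncurry m))
    (hinthat : TermsIntegrable P k S a t p m)
    (hν : (P.fst.prod volume).withDensity (fun v => ENNReal.ofReal (|k (v.2 - a)| *
        (1 + |μ v.1 v.2| + |S (p v.1 v.2) t / p v.1 v.2|))) ≤ C • ν)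
    (hφ : Integrable (eifDen k S a t p) P) :
    ‖∫ z, eifDen k S a t p z ∂P - psiDen P k S a t π‖ₑ ≤ C * (1 + L) *
      ((nuisanceDist ν p π + nuisanceDist ν m μ) * nuisanceDist ν p π) := by
  obtain ⟨h1, h2⟩ := integral_eifDen hπ hk hS₂.continuous.measurable hp hinthat hφ
  rw [h2, psiDen, ← integral_prod _ hint.den, ← integral_sub h1 hint.den]
  have hp' : Measurable fun v : 𝒳 × ℝ => p v.1 v.2 := hp
  have hμ' : Measurable fun v : 𝒳 × ℝ => μ v.1 v.2 := hμ.measurable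
  have hS' : Measurable fun v : 𝒳 × ℝ => S (p v.1 v.2) t := hS.continuous.measurable.comp hp'
  have hw : Measurable fun v : 𝒳 × ℝ =>
      |k (v.2 - a)| * (1 + |μ v.1 v.2| + |S (p v.1 v.2) t / p v.1 v.2|) :=
    (hk.comp (measurable_snd.sub_const a)).abs.mul
      ((measurable_const.add hμ'.abs).add (hS'.div hp').abs)
  refine enorm_integral_le_nuisanceDist hπ.measurable hμ.measurable hp hm hw
    (fun v => by positivity) hν ?_
  exact .of_forall fun v => abs_den_bias_le hS hS₂

end Bias

/-! ### Empirical processes indexed by independent estimates. -/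

theorem variance_le_sq_of_eLpNorm_le {α : Type*} [MeasurableSpace α] {P : Measure α}
    [IsProbabilityMeasure P] {g : α → ℝ} (hg : Measurable g) {δ : ℝ} (hδ : 0 ≤ δ)
    (h : eLpNorm g 2 P ≤ ENNReal.ofReal δ) : Var[g; P] ≤ δ ^ 2 := by
  have hL : MemLp g 2 P := ⟨hg.aestronglyMeasurable, h.trans_lt ENNReal.ofReal_lt_top⟩
  rw [← ENNReal.ofReal_le_ofReal_iff (by positivity), hL.ofReal_variance_eq,
    evariance_def' hL.1, ENNReal.ofReal_pow hδ]
  refine tsub_le_self.trans ?_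
  have e : eLpNorm g 2 P ^ 2 = ∫⁻ x, ‖g x‖ₑ ^ 2 ∂P := by
    rw [eLpNorm_eq_lintegral_rpow_enorm_toReal two_ne_zero ENNReal.ofNat_ne_top, ← ENNReal.rpow_two]
    simp only [ENNReal.toReal_ofNat, one_div]
    rw [← ENNReal.rpow_mul, inv_mul_cancel₀ (two_ne_zero : (2 : ℝ) ≠ 0), ENNReal.rpow_one]
    simp
  rw [← e]
  gcongr

section Sampling

variable {𝒳 : Type*} [MeasurableSpace 𝒳] {Ω : Type*} [MeasurableSpace Ω]
  {Pr : Measure Ω} [IsProbabilityMeasure Pr] {P : Measure (Obs 𝒳)} [IsProbabilityMeasure P]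
  {Z : ℕ → Ω → Obs 𝒳}

omit [IsProbabilityMeasure Pr] [IsProbabilityMeasure P] in
theorem identDistrib_comp (hZ : ∀ i, Measurable (Z i)) (hZlaw : ∀ i, Pr.map (Z i) = P)
    {g : Obs 𝒳 → ℝ} (hg : Measurable g) (i : ℕ) :
    IdentDistrib (fun ω => g (Z i ω)) g Pr P where
  aemeasurable_fst := (hg.comp (hZ i)).aemeasurable
  aemeasurable_snd := hg.aemeasurable
  map_eq := by rw [← hZlaw i, Measure.map_map hg (hZ i)]; rfl

/-- Chebyshev: for `n > 0` the scaled average has variance `Var g ≤ δ ^ 2`, uniformly in `n`. -/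
theorem measure_empiricalProcess_ge_le (hZ : ∀ i, Measurable (Z i))
    (hZlaw : ∀ i, Pr.map (Z i) = P) (hZind : iIndepFun Z Pr) {g : Obs 𝒳 → ℝ} (hg : Measurable g)
    {δ ε : ℝ} (hδ : 0 ≤ δ) (hε : 0 < ε) (h : eLpNorm g 2 P ≤ ENNReal.ofReal δ) (n : ℕ) :
    Pr {ω | ε ≤ |√n * (sampleMean n (fun i => Z i ω) g - ∫ z, g z ∂P)|}
      ≤ ENNReal.ofReal (δ ^ 2 / ε ^ 2) := by
  rcases Nat.eq_zero_or_pos n with rfl | hn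
  · simp [hε.not_ge]
  have hn0 : (n : ℝ) ≠ 0 := by positivity
  have hL : MemLp g 2 P := ⟨hg.aestronglyMeasurable, h.trans_lt ENNReal.ofReal_lt_top⟩
  have hid := identDistrib_comp hZ hZlaw hg
  have hLi : ∀ i, MemLp (fun ω => g (Z i ω)) 2 Pr := fun i => (hid i).memLp_iff.2 hL
  have hLs : MemLp (∑ i ∈ Finset.range n, fun ω => g (Z i ω)) 2 Pr :=
    memLp_finsetSum' _ fun i _ => hLi i
  set T : Ω → ℝ := fun ω => (√n * (n : ℝ)⁻¹) * (∑ i ∈ Finset.range n, fun ω => g (Z i ω)) ω with hT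
  have hLT : MemLp T 2 Pr := hLs.const_mul _
  have hmean : ∫ ω, T ω ∂Pr = √n * ∫ z, g z ∂P := by
    simp only [hT, Finset.sum_apply]
    rw [integral_const_mul, integral_finsetSum _ fun i _ => (hLi i).integrable one_le_two]
    rw [Finset.sum_congr rfl fun i _ => (hid i).integral_eq]
    simp only [Finset.sum_const, Finset.card_range, nsmul_eq_mul]
    field_simp
  have hvar : Var[T; Pr] ≤ δ ^ 2 := by
    have hind : Set.Pairwise ↑(Finset.range n) fun i j =>
        (fun ω => g (Z i ω)) ⟂ᵢ[Pr] (fun ω => g (Z j ω)) := fun i _ j _ hij =>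
      (hZind.indepFun hij).comp hg hg
    rw [hT, variance_const_mul, IndepFun.variance_sum (fun i _ => hLi i) hind,
      Finset.sum_congr rfl fun i _ => (hid i).variance_eq]
    simp only [Finset.sum_const, Finset.card_range, nsmul_eq_mul]
    rw [mul_pow, Real.sq_sqrt (Nat.cast_nonneg n)]
    refine le_of_eq_of_le ?_ (variance_le_sq_of_eLpNorm_le hg hδ h)
    field_simp
  refine le_trans (le_of_eq ?_) ((meas_ge_le_variance_div_sq hLT hε).trans ?_)
  · rw [hmean]
    congr 1 with ω
    simp only [hT, sampleMean, Finset.sum_apply, Set.mem_ofPred_eq]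
    rw [mul_sub, mul_assoc]
  · gcongr

theorem measurable_sampleMean {𝒯 : Type*} [MeasurableSpace 𝒯] {g : 𝒯 → Obs 𝒳 → ℝ}
    (hg : Measurable (Function.uncurry g)) (n : ℕ) :
    Measurable fun w : 𝒯 × (ℕ → Obs 𝒳) => sampleMean n w.2 (g w.1) := by
  unfold sampleMean
  refine measurable_const.mul (Finset.measurable_fun_sum _ fun i _ => ?_)
  exact hg.comp (measurable_fst.prodMk ((measurable_pi_apply i).comp measurable_snd))

theorem measurable_eLpNorm_two {𝒯 : Type*} [MeasurableSpace 𝒯] {g : 𝒯 → Obs 𝒳 → ℝ}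
    (hg : Measurable (Function.uncurry g)) : Measurable fun d => eLpNorm (g d) 2 P := by
  simp only [eLpNorm_eq_lintegral_rpow_enorm_toReal (p := 2) two_ne_zero ENNReal.ofNat_ne_top]
  have : Measurable fun w : 𝒯 × Obs 𝒳 => ‖g w.1 w.2‖ₑ ^ (2 : ℝ≥0∞).toReal :=
    (Measurable.enorm hg).pow_const _
  exact (this.lintegral_prod_right').pow_const _

/-- By independence the joint law of `D` and the sample is a product, so Fubini freezes `D` and the
bound for a fixed function applies on each section. -/
theorem measure_empiricalProcess_indep_ge_le (hZ : ∀ i, Measurable (Z i))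
    (hZlaw : ∀ i, Pr.map (Z i) = P) (hZind : iIndepFun Z Pr) {𝒯 : Type*} [MeasurableSpace 𝒯]
    {D : Ω → 𝒯} (hD : Measurable D) (hDind : IndepFun D (fun ω i => Z i ω) Pr)
    {g : 𝒯 → Obs 𝒳 → ℝ} (hg : Measurable (Function.uncurry g))
    {δ ε : ℝ} (hδ : 0 ≤ δ) (hε : 0 < ε) (n : ℕ) :
    Pr {ω | ε ≤ |√n * (sampleMean n (fun i => Z i ω) (g (D ω)) - ∫ z, g (D ω) z ∂P)|}
      ≤ Pr {ω | ENNReal.ofReal δ < eLpNorm (g (D ω)) 2 P} + ENNReal.ofReal (δ ^ 2 / ε ^ 2) := by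
  have hZm : Measurable fun ω i => Z i ω := measurable_pi_lambda _ hZ
  set A : Set (𝒯 × (ℕ → Obs 𝒳)) := {w | eLpNorm (g w.1) 2 P ≤ ENNReal.ofReal δ} ∩
    {w | ε ≤ |√n * (sampleMean n w.2 (g w.1) - ∫ z, g w.1 z ∂P)|} with hA
  have hAm : MeasurableSet A := by
    have hi : Measurable fun d => ∫ z, g d z ∂P :=
      (hg.stronglyMeasurable.integral_prod_right).measurable
    refine ((measurableSet_le ((measurable_eLpNorm_two hg).comp measurable_fst)
      measurable_const)).inter (measurableSet_le measurable_const ?_)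
    exact (measurable_const.mul ((measurable_sampleMean hg n).sub (hi.comp measurable_fst))).abs
  have hsub : {ω | ε ≤ |√n * (sampleMean n (fun i => Z i ω) (g (D ω)) - ∫ z, g (D ω) z ∂P)|} ⊆
      {ω | ENNReal.ofReal δ < eLpNorm (g (D ω)) 2 P} ∪ (fun ω => (D ω, fun i => Z i ω)) ⁻¹' A := by
    intro ω hω
    rcases lt_or_ge (ENNReal.ofReal δ) (eLpNorm (g (D ω)) 2 P) with h | h
    · exact .inl h
    · exact .inr ⟨h, hω⟩
  refine (measure_mono hsub).trans ((measure_union_le _ _).trans (add_le_add_right ?_ _))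
  have hlaw := hDind.map_prod_eq_prod_map_map hD.aemeasurable hZm.aemeasurable
  have := Measure.isProbabilityMeasure_map (μ := Pr) hD.aemeasurable
  have := Measure.isProbabilityMeasure_map (μ := Pr) hZm.aemeasurable
  rw [← Measure.map_apply (hD.prodMk hZm) hAm, hlaw, Measure.prod_apply hAm]
  refine (lintegral_mono (g := fun _ => ENNReal.ofReal (δ ^ 2 / ε ^ 2)) fun d => ?_).trans
    (by simp)
  rw [Measure.map_apply hZm (hAm.preimage measurable_prodMk_left)]
  by_cases h : eLpNorm (g d) 2 P ≤ ENNReal.ofReal δ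
  · refine (measure_mono ?_).trans (measure_empiricalProcess_ge_le hZ hZlaw hZind
      (hg.comp measurable_prodMk_left) hδ hε h n)
    exact fun ω hω => hω.2
  -- The norm constraint is part of `A`, so the section over such a `d` is empty.
  · refine le_of_eq_of_le ?_ zero_le
    refine measure_mono_null (t := ∅) (fun ω hω => (h hω.1).elim) measure_empty

theorem tendstoInMeasure_empiricalProcess_indep (hZ : ∀ i, Measurable (Z i))
    (hZlaw : ∀ i, Pr.map (Z i) = P) (hZind : iIndepFun Z Pr)
    {𝒯 : ℕ → Type*} [∀ n, MeasurableSpace (𝒯 n)] {D : (n : ℕ) → Ω → 𝒯 n}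
    (hD : ∀ n, Measurable (D n)) (hDind : ∀ n, IndepFun (D n) (fun ω i => Z i ω) Pr)
    {g : (n : ℕ) → 𝒯 n → Obs 𝒳 → ℝ} (hg : ∀ n, Measurable (Function.uncurry (g n)))
    (hcons : IsLittleOP Pr (fun n ω => eLpNorm (g n (D n ω)) 2 P) (fun _ => 1)) :
    TendstoInMeasure Pr (fun (n : ℕ) ω =>
      √n * (sampleMean n (fun i => Z i ω) (g n (D n ω)) - ∫ z, g n (D n ω) z ∂P))
      atTop (fun _ => 0) := by
  rw [tendstoInMeasure_iff_norm]
  intro ε hε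
  simp only [sub_zero, Real.norm_eq_abs]
  rw [ENNReal.tendsto_nhds_zero]
  intro c hc
  obtain ⟨r, hr0, hrc⟩ : ∃ r : ℝ, 0 < r ∧ ENNReal.ofReal r ≤ c / 2 := by
    obtain ⟨r, hr0, hr⟩ := ENNReal.lt_iff_exists_real_btwn.1 (ENNReal.half_pos hc.ne')
    exact ⟨r, ENNReal.ofReal_pos.1 hr.1, hr.2.le⟩
  -- With `δ = ε√r` the Chebyshev bound `δ ^ 2 / ε ^ 2` is exactly `r`.
  have hδ : 0 < ε * √r := by positivity
  have hlim := (ENNReal.tendsto_nhds_zero.1 (hcons (ε * √r) hδ)) (c / 2) (ENNReal.half_pos hc.ne')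
  filter_upwards [hlim] with n hn
  refine (measure_empiricalProcess_indep_ge_le hZ hZlaw hZind (hD n) (hDind n) (hg n)
    hδ.le hε n).trans ?_
  rw [← ENNReal.add_halves c]
  rw [mul_one] at hn
  refine add_le_add hn (le_trans (le_of_eq ?_) hrc)
  rw [mul_pow, Real.sq_sqrt hr0.le]
  congr 1
  field_simp

/-- Replacing an influence function by an independent consistent estimate of it changes the
sample average by `o_P(n^{-1/2})`, if the bias of the estimate is of that order. -/
theorem tendstoInMeasure_sampleMean_sub (hZ : ∀ i, Measurable (Z i))
    (hZlaw : ∀ i, Pr.map (Z i) = P) (hZind : iIndepFun Z Pr)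
    {𝒯 : ℕ → Type*} [∀ n, MeasurableSpace (𝒯 n)] {D : (n : ℕ) → Ω → 𝒯 n}
    (hD : ∀ n, Measurable (D n)) (hDind : ∀ n, IndepFun (D n) (fun ω i => Z i ω) Pr)
    {Φ : (n : ℕ) → 𝒯 n → Obs 𝒳 → ℝ} (hΦ : ∀ n, Measurable (Function.uncurry (Φ n)))
    {φ : Obs 𝒳 → ℝ} (hφ : Measurable φ)
    (hcons : IsLittleOP Pr (fun n ω => eLpNorm (fun z => Φ n (D n ω) z - φ z) 2 P) (fun _ => 1))
    {V : ℕ → Ω → ℝ≥0∞} (hV : IsLittleOP Pr V (fun n => (n : ℝ) ^ (-(1 / 2) : ℝ))) {c : ℝ≥0}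
    (hbias : ∀ᶠ n in atTop, ∀ᵐ ω ∂Pr, MemLp (fun z => Φ n (D n ω) z - φ z) 2 P →
      ‖∫ z, Φ n (D n ω) z - φ z ∂P‖ₑ ≤ c * V n ω) :
    TendstoInMeasure Pr (fun (n : ℕ) ω =>
      √n * (sampleMean n (fun i => Z i ω) (Φ n (D n ω)) - sampleMean n (fun i => Z i ω) φ))
      atTop (fun _ => 0) := by
  have hgm : ∀ n, Measurable (Function.uncurry fun (d : 𝒯 n) z => Φ n d z - φ z) := fun n =>
    (hΦ n).sub (hφ.comp measurable_snd)
  have hemp := tendstoInMeasure_empiricalProcess_indep hZ hZlaw hZind hD hDind hgm hcons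
  rw [tendstoInMeasure_iff_norm] at hemp ⊢
  intro ε hε
  -- Chosen so that the scaled bias is at most `ε / 4`; the `+ 1` covers `c = 0`. Together with a
  -- fluctuation below `ε / 2` this stays under `ε`.
  have hη : 0 < ε / (4 * (c + 1)) := by positivity
  -- Consistency is also used at threshold `1`, only to make the `L₂` norm finite so that `hbias`
  -- applies.
  have hlim := ((hemp (ε / 2) (by positivity)).add (hcons 1 one_pos)).add (hV _ hη)
  simp only [add_zero] at hlim
  refine tendsto_of_tendsto_of_tendsto_of_le_of_le' tendsto_const_nhds hlim
    (.of_forall fun _ => zero_le) ?_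
  filter_upwards [hbias, eventually_gt_atTop 0] with n hn hn0
  refine (measure_mono_ae ?_).trans ((measure_union_le _ _).trans
    (add_le_add_left (measure_union_le _ _) _))
  filter_upwards [hn] with ω hω hωε
  by_contra hcon
  replace hcon : ω ∉ (_ ∪ _ ∪ _ : Set Ω) := hcon
  replace hωε : ε ≤ ‖√n * (sampleMean n (fun i => Z i ω) (Φ n (D n ω))
    - sampleMean n (fun i => Z i ω) φ) - 0‖ := hωε
  simp only [Set.mem_union, Set.mem_ofPred_eq, not_or, not_le, not_lt, sub_zero, mul_one,
    Real.norm_eq_abs] at hcon hωε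
  obtain ⟨⟨h1, h2⟩, h3⟩ := hcon
  have hb := hω ⟨((hgm n).comp measurable_prodMk_left).aestronglyMeasurable,
    h2.trans_lt ENNReal.ofReal_lt_top⟩
  set I := ∫ z, Φ n (D n ω) z - φ z ∂P with hI
  have hs : √(n : ℝ) * (n : ℝ) ^ (-(1 / 2) : ℝ) = 1 := by
    rw [Real.rpow_neg (Nat.cast_nonneg n), ← Real.sqrt_eq_rpow]
    exact mul_inv_cancel₀ (by positivity)
  have hI' : |I| ≤ c * (ε / (4 * (c + 1)) * (n : ℝ) ^ (-(1 / 2) : ℝ)) := by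
    rw [← ENNReal.ofReal_le_ofReal_iff (by positivity), ← Real.enorm_eq_ofReal_abs,
      ENNReal.ofReal_mul c.coe_nonneg]
    refine hb.trans ?_
    rw [ENNReal.ofReal_coe_nnreal]
    gcongr
  have hI'' : |√n * I| ≤ ε / 4 := by
    rw [abs_mul, abs_of_nonneg (Real.sqrt_nonneg _)]
    calc √n * |I| ≤ √n * (c * (ε / (4 * (c + 1)) * (n : ℝ) ^ (-(1 / 2) : ℝ))) := by gcongr
      _ = c * (ε / (4 * (c + 1))) * (√n * (n : ℝ) ^ (-(1 / 2) : ℝ)) := by ring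
      _ = (ε / 4) * (c / (c + 1)) := by rw [hs]; field_simp
      _ ≤ (ε / 4) * 1 := by
        gcongr
        exact div_le_one_of_le₀ (by linarith) (by positivity)
      _ = ε / 4 := mul_one _
  have hsub : sampleMean n (fun i => Z i ω) (fun z => Φ n (D n ω) z - φ z) =
      sampleMean n (fun i => Z i ω) (Φ n (D n ω)) - sampleMean n (fun i => Z i ω) φ := by
    simp only [sampleMean, Finset.sum_sub_distrib, mul_sub]
  rw [hsub, mul_sub] at h1
  have := abs_sub_le (√n * (sampleMean n (fun i => Z i ω) (Φ n (D n ω))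
    - sampleMean n (fun i => Z i ω) φ)) (√n * I) 0
  simp only [sub_zero] at this
  linarith

omit [IsProbabilityMeasure Pr] in
theorem tendstoInMeasure_comp_continuousAt {Y : ℕ → Ω → ℝ} {c : ℝ} {g : ℝ → ℝ}
    (hg : ContinuousAt g c) (hY : TendstoInMeasure Pr Y atTop (fun _ => c)) :
    TendstoInMeasure Pr (fun n ω => g (Y n ω)) atTop (fun _ => g c) := by
  rw [tendstoInMeasure_iff_dist] at hY ⊢
  intro ε hε
  obtain ⟨δ, hδ, h⟩ := Metric.continuousAt_iff.1 hg ε hε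
  refine tendsto_of_tendsto_of_tendsto_of_le_of_le tendsto_const_nhds (hY δ hδ)
    (fun _ => zero_le) fun n => measure_mono fun ω hω => ?_
  by_contra hc
  exact (h (not_le.1 hc)).not_ge hω

end Sampling

/-! ### Joint measurability of the influence functions in data and observation. -/

theorem measurable_eifNum {𝒳 𝒯 : Type*} [MeasurableSpace 𝒳] [MeasurableSpace 𝒯] {k : ℝ → ℝ}
    {S : ℝ → ℝ → ℝ} {a t : ℝ} (hk : Measurable k) (hS : Measurable fun q => S q t)
    (hdS : Measurable fun q => dS S q t) {p m : 𝒯 → 𝒳 → ℝ → ℝ}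
    (hp : Measurable fun w : 𝒯 × 𝒳 × ℝ => p w.1 w.2.1 w.2.2)
    (hm : Measurable fun w : 𝒯 × 𝒳 × ℝ => m w.1 w.2.1 w.2.2) :
    Measurable (Function.uncurry fun d (z : Obs 𝒳) => eifNum k S a t (p d) (m d) z) := by
  have hS' : Measurable fun w : 𝒯 × 𝒳 × ℝ => S (p w.1 w.2.1 w.2.2) t := hS.comp hp
  have hdS' : Measurable fun w : 𝒯 × 𝒳 × ℝ => dS S (p w.1 w.2.1 w.2.2) t := hdS.comp hp
  have hk' : Measurable fun w : 𝒯 × 𝒳 × ℝ => k (w.2.2 - a) := by fun_prop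
  have hr : Measurable fun w : 𝒯 × Obs 𝒳 => (w.1, w.2.1, w.2.2.1) := by fun_prop
  have hr' : Measurable fun w : (𝒯 × Obs 𝒳) × ℝ => (w.1.1, w.1.2.1, w.2) := by fun_prop
  have i2 : Measurable fun w : 𝒯 × Obs 𝒳 =>
      ∫ a₀, k (a₀ - a) * S (p w.1 w.2.1 a₀) t * m w.1 w.2.1 a₀ :=
    (((hk'.mul hS').mul hm).comp hr').stronglyMeasurable.integral_prod_right'.measurable
  have i4 : Measurable fun w : 𝒯 × Obs 𝒳 =>
      ∫ a₀, k (a₀ - a) * m w.1 w.2.1 a₀ * dS S (p w.1 w.2.1 a₀) t * p w.1 w.2.1 a₀ :=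
    ((((hk'.mul hm).mul hdS').mul hp).comp hr').stronglyMeasurable.integral_prod_right'.measurable
  have hy : Measurable fun w : 𝒯 × Obs 𝒳 => w.2.2.2 := by fun_prop
  have h1 := (hk'.comp hr).mul (((hy.sub (hm.comp hr)).mul (hS'.comp hr)).div (hp.comp hr))
  have h3 := ((hk'.comp hr).mul (hm.comp hr)).mul (hdS'.comp hr)
  exact ((h1.add i2).add h3).sub i4

theorem measurable_eifDen {𝒳 𝒯 : Type*} [MeasurableSpace 𝒳] [MeasurableSpace 𝒯] {k : ℝ → ℝ}
    {S : ℝ → ℝ → ℝ} {a t : ℝ} (hk : Measurable k) (hS : Measurable fun q => S q t)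
    (hdS : Measurable fun q => dS S q t) {p : 𝒯 → 𝒳 → ℝ → ℝ}
    (hp : Measurable fun w : 𝒯 × 𝒳 × ℝ => p w.1 w.2.1 w.2.2) :
    Measurable (Function.uncurry fun d (z : Obs 𝒳) => eifDen k S a t (p d) z) := by
  have hS' : Measurable fun w : 𝒯 × 𝒳 × ℝ => S (p w.1 w.2.1 w.2.2) t := hS.comp hp
  have hdS' : Measurable fun w : 𝒯 × 𝒳 × ℝ => dS S (p w.1 w.2.1 w.2.2) t := hdS.comp hp
  have hk' : Measurable fun w : 𝒯 × 𝒳 × ℝ => k (w.2.2 - a) := by fun_prop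
  have hr : Measurable fun w : 𝒯 × Obs 𝒳 => (w.1, w.2.1, w.2.2.1) := by fun_prop
  have hr' : Measurable fun w : (𝒯 × Obs 𝒳) × ℝ => (w.1.1, w.1.2.1, w.2) := by fun_prop
  have i2 : Measurable fun w : 𝒯 × Obs 𝒳 => ∫ a₀, k (a₀ - a) * S (p w.1 w.2.1 a₀) t :=
    ((hk'.mul hS').comp hr').stronglyMeasurable.integral_prod_right'.measurable
  have i4 : Measurable fun w : 𝒯 × Obs 𝒳 =>
      ∫ a₀, k (a₀ - a) * dS S (p w.1 w.2.1 a₀) t * p w.1 w.2.1 a₀ :=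
    (((hk'.mul hdS').mul hp).comp hr').stronglyMeasurable.integral_prod_right'.measurable
  exact (i2.add ((hk'.comp hr).mul (hdS'.comp hr))).sub i4

/-! ### Limit theorems and the delta method for a ratio. -/

section Ratio

variable {𝒳 : Type*} [MeasurableSpace 𝒳] {Ω : Type*} [MeasurableSpace Ω]
  {Pr : Measure Ω} [IsProbabilityMeasure Pr] {P : Measure (Obs 𝒳)} [IsProbabilityMeasure P]
  {Z : ℕ → Ω → Obs 𝒳}

omit [IsProbabilityMeasure P] in
theorem tendstoInDistribution_sampleMean (hZ : ∀ i, Measurable (Z i))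
    (hZlaw : ∀ i, Pr.map (Z i) = P) (hZind : iIndepFun Z Pr) {g : Obs 𝒳 → ℝ} (hg : Measurable g)
    (hL : MemLp g 2 P) (h0 : ∫ z, g z ∂P = 0) :
    TendstoInDistribution (fun (n : ℕ) ω => √n * sampleMean n (fun i => Z i ω) g) atTop
      (id : ℝ → ℝ) (fun _ => Pr) (gaussianReal 0 Var[g; P].toNNReal) := by
  have hid := identDistrib_comp hZ hZlaw hg
  have h := tendstoInDistribution_inv_sqrt_mul_sum_sub (P := Pr) (X := fun i ω => g (Z i ω))
    (Y := (id : ℝ → ℝ)) (P' := gaussianReal 0 Var[g; P].toNNReal)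
    ⟨aemeasurable_id, by rw [Measure.map_id, (hid 0).variance_eq]⟩
    ((hid 0).memLp_iff.2 hL) (hZind.comp _ fun _ => hg)
    fun i => (hid i).trans (hid 0).symm
  rw [(hid 0).integral_eq, h0] at h
  refine h.congr (fun n => .of_forall fun ω => ?_) .rfl
  simp only [sampleMean, mul_zero, sub_zero, ← mul_assoc]
  congr 1
  rcases Nat.eq_zero_or_pos n with rfl | hn
  · simp
  · have : (0 : ℝ) < n := by exact_mod_cast hn
    rw [← div_eq_mul_inv, Real.sqrt_div_self]

omit [IsProbabilityMeasure P] in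
theorem tendstoInMeasure_sampleMean (hZ : ∀ i, Measurable (Z i))
    (hZlaw : ∀ i, Pr.map (Z i) = P) (hZind : iIndepFun Z Pr) {g : Obs 𝒳 → ℝ} (hg : Measurable g)
    (hL : Integrable g P) :
    TendstoInMeasure Pr (fun n ω => sampleMean n (fun i => Z i ω) g) atTop
      (fun _ => ∫ z, g z ∂P) := by
  have hid := identDistrib_comp hZ hZlaw hg
  refine tendstoInMeasure_of_tendsto_ae (fun n => Measurable.aestronglyMeasurable ?_) ?_
  · unfold sampleMean
    exact measurable_const.mul (Finset.measurable_fun_sum _ fun i _ => hg.comp (hZ i))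
  have := strong_law_ae (μ := Pr) (fun i ω => g (Z i ω)) ((hid 0).integrable_iff.2 hL)
    (fun i j hij => (hZind.indepFun hij).comp hg hg) fun i => (hid i).trans (hid 0).symm
  rw [(hid 0).integral_eq] at this
  exact this

omit [IsProbabilityMeasure Pr] in
theorem TendstoInMeasure.add_real {f g : ℕ → Ω → ℝ} {c d : ℝ}
    (hf : TendstoInMeasure Pr f atTop fun _ => c) (hg : TendstoInMeasure Pr g atTop fun _ => d) :
    TendstoInMeasure Pr (fun n ω => f n ω + g n ω) atTop fun _ => c + d := by
  rw [tendstoInMeasure_iff_norm] at hf hg ⊢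
  intro ε hε
  have hlim := (hf (ε / 2) (by positivity)).add (hg (ε / 2) (by positivity))
  rw [add_zero] at hlim
  refine tendsto_of_tendsto_of_tendsto_of_le_of_le tendsto_const_nhds hlim
    (fun _ => zero_le) fun n => (measure_mono fun ω hω => ?_).trans (measure_union_le _ _)
  by_contra hcon
  simp only [Set.mem_union, Set.mem_ofPred_eq, not_or, not_le] at hcon hω
  have := norm_add_le (f n ω - c) (g n ω - d)
  rw [← add_sub_add_comm] at this
  linarith [hcon.1, hcon.2]

/-- The delta method for a ratio of asymptotically linear estimators. -/
theorem tendstoInDistribution_ratio (hZ : ∀ i, Measurable (Z i))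
    (hZlaw : ∀ i, Pr.map (Z i) = P) (hZind : iIndepFun Z Pr) {φ χ : Obs 𝒳 → ℝ}
    (hφ : Measurable φ) (hχ : Measurable χ) (hφ2 : MemLp φ 2 P) (hχ2 : MemLp χ 2 P)
    (hχ0 : ∫ z, χ z ∂P ≠ 0) {A B : ℕ → Ω → ℝ} (hA : ∀ n, Measurable (A n))
    (hB : ∀ n, Measurable (B n))
    (hRA : TendstoInMeasure Pr (fun (n : ℕ) ω =>
      √n * (A n ω - sampleMean n (fun i => Z i ω) φ)) atTop fun _ => 0)
    (hRB : TendstoInMeasure Pr (fun (n : ℕ) ω =>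
      √n * (B n ω - sampleMean n (fun i => Z i ω) χ)) atTop fun _ => 0) :
    TendstoInDistribution
      (fun (n : ℕ) ω => √n * (A n ω / B n ω - (∫ z, φ z ∂P) / ∫ z, χ z ∂P))
      atTop (id : ℝ → ℝ) (fun _ => Pr)
      (gaussianReal 0 (Var[fun z => (φ z - (∫ z, φ z ∂P) / (∫ z, χ z ∂P) * χ z) / ∫ z, χ z ∂P;
        P]).toNNReal) := by
  set d := ∫ z, χ z ∂P with hd
  set r := (∫ z, φ z ∂P) / d with hr
  set ξ : Obs 𝒳 → ℝ := fun z => (φ z - r * χ z) / d with hξ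
  have hξm : Measurable ξ := by fun_prop
  have hξ2 : MemLp ξ 2 P := by
    simpa only [hξ, div_eq_inv_mul] using! (hφ2.sub (hχ2.const_mul r)).const_mul d⁻¹
  have hξ0 : ∫ z, ξ z ∂P = 0 := by
    simp only [hξ]
    rw [integral_div, integral_sub (hφ2.integrable one_le_two)
      ((hχ2.integrable one_le_two).const_mul r), integral_const_mul, ← hd, hr,
      div_mul_cancel₀ _ hχ0, sub_self, zero_div]
  have hclt := tendstoInDistribution_sampleMean hZ hZlaw hZind hξm hξ2 hξ0
  have hBlim : TendstoInMeasure Pr B atTop fun _ => d := by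
    have hdiff : TendstoInMeasure Pr (fun n ω => B n ω - sampleMean n (fun i => Z i ω) χ) atTop
        fun _ => 0 := by
      rw [tendstoInMeasure_iff_norm] at hRB ⊢
      intro ε hε
      refine tendsto_of_tendsto_of_tendsto_of_le_of_le' tendsto_const_nhds (hRB ε hε)
        (.of_forall fun _ => zero_le) ?_
      filter_upwards [eventually_ge_atTop 1] with n hn
      refine measure_mono fun ω hω => ?_
      simp only [Set.mem_ofPred_eq, sub_zero, norm_mul] at hω ⊢
      have h1 : 1 ≤ ‖√(n : ℝ)‖ := by
        rw [Real.norm_of_nonneg (Real.sqrt_nonneg _), Real.one_le_sqrt]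
        exact_mod_cast hn
      exact hω.trans (le_mul_of_one_le_left (norm_nonneg _) h1)
    have := TendstoInMeasure.add_real hdiff
      (tendstoInMeasure_sampleMean hZ hZlaw hZind hχ (hχ2.integrable one_le_two))
    simpa only [sub_add_cancel, zero_add] using this
  have hinv : TendstoInMeasure Pr (fun n ω => d / B n ω) atTop fun _ => 1 := by
    have := tendstoInMeasure_comp_continuousAt (g := fun x => d / x)
      (continuousAt_const.div continuousAt_id hχ0) hBlim
    rwa [div_self hχ0] at this
  -- Since `A - r * B` is linear in the pair, its scaled version differs from the average of `ξ`
  -- only by the two given remainders.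
  have hlin : TendstoInMeasure Pr (fun (n : ℕ) ω => √n * (A n ω - r * B n ω) / d
      - √n * sampleMean n (fun i => Z i ω) ξ) atTop fun _ => 0 := by
    have h1 := tendstoInMeasure_comp_continuousAt (g := fun x => x / d) (by fun_prop) hRA
    have h2 := tendstoInMeasure_comp_continuousAt (g := fun x => -(r * x / d)) (by fun_prop) hRB
    have := TendstoInMeasure.add_real h1 h2
    simp only [zero_div, mul_zero, neg_zero, add_zero] at this
    refine this.congr_left fun n => .of_forall fun ω => ?_
    have hs : sampleMean n (fun i => Z i ω) ξ = (sampleMean n (fun i => Z i ω) φ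
        - r * sampleMean n (fun i => Z i ω) χ) / d := by
      simp only [sampleMean, hξ, ← Finset.sum_div, Finset.sum_sub_distrib, ← Finset.mul_sum]
      ring
    simp only [hs]
    ring
  have hW := tendstoInDistribution_of_tendstoInMeasure_sub
    (fun (n : ℕ) ω => √n * (A n ω - r * B n ω) / d) id hclt hlin
    fun n => Measurable.aemeasurable (by fun_prop)
  have hprod := hW.continuous_comp_prodMk_of_tendstoInMeasure_const
    (g := fun x : ℝ × ℝ => x.1 * x.2) (by fun_prop) hinv
    fun n => Measurable.aemeasurable (by fun_prop)
  simp only [id, mul_one] at hprod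
  -- Where `B ≠ 0`, `A / B - r` equals `(A - r * B) / d * (d / B)` exactly. The event `B = 0` lies
  -- in `|B - d| ≥ |d|`, whose probability vanishes.
  refine tendstoInDistribution_of_tendstoInMeasure_sub _ id hprod ?_
    fun n => Measurable.aemeasurable (by fun_prop)
  rw [tendstoInMeasure_iff_norm] at hBlim ⊢
  intro ε hε
  refine tendsto_of_tendsto_of_tendsto_of_le_of_le tendsto_const_nhds
    (hBlim ‖d‖ (norm_pos_iff.2 hχ0)) (fun _ => zero_le) fun n => measure_mono fun ω hω => ?_
  rcases eq_or_ne (B n ω) 0 with h0 | h0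
  · simp [h0]
  · exfalso
    have e : √(n : ℝ) * (A n ω / B n ω - r) - √n * (A n ω - r * B n ω) / d * (d / B n ω) = 0 := by
      field_simp; ring
    simp only [Set.mem_ofPred_eq, Pi.sub_apply, e, Pi.zero_apply, sub_zero, norm_zero] at hω
    linarith

end Ratio

/-! ### Assembly. -/

theorem proposition1
    {𝒳 : Type*} [MeasurableSpace 𝒳] {Ω : Type*} [MeasurableSpace Ω]
    (Pr : Measure Ω) [IsProbabilityMeasure Pr]
    -- the law of an observation, its propensity score and its outcome regression
    (P : Measure (Obs 𝒳)) [IsProbabilityMeasure P]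
    (π μ : 𝒳 → ℝ → ℝ) (hπ : IsPropensityScore P π) (hμ : IsOutcomeRegression P μ)
    -- kernel, bandwidth, smoothed indicator, target treatment value, fixed threshold
    (K : ℝ → ℝ) (hK : Measurable K) (h : ℝ) (hh : 0 < h) (S : ℝ → ℝ → ℝ) (a t : ℝ) (L : ℝ≥0)
    (hS : Differentiable ℝ (fun p => S p t)) (hS₁ : ∀ p, |dS S p t| ≤ L)
    (hS₂ : LipschitzWith L (fun p => dS S p t))
    -- the estimand is well defined and the influence functions have finite variance
    (hint : TermsIntegrable P (scaledKernel K h) S a t π μ)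
    (hden : psiDen P (scaledKernel K h) S a t π ≠ 0)
    (hnum2 : MemLp (eifNum (scaledKernel K h) S a t π μ) 2 P)
    (hden2 : MemLp (eifDen (scaledKernel K h) S a t π) 2 P)
    -- the i.i.d. sample on which the estimator is computed
    (Z : ℕ → Ω → Obs 𝒳) (hZ : ∀ i, Measurable (Z i)) (hZlaw : ∀ i, Pr.map (Z i) = P)
    (hZind : iIndepFun Z Pr)
    -- the independent data `D n` (for example `n` further observations) and the nuisance
    -- estimators computed from them
    (𝒯 : ℕ → Type*) [∀ n, MeasurableSpace (𝒯 n)] (D : (n : ℕ) → Ω → 𝒯 n)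
    (hD : ∀ n, Measurable (D n)) (hDind : ∀ n, IndepFun (D n) (fun ω i => Z i ω) Pr)
    (πhat μhat : (n : ℕ) → 𝒯 n → 𝒳 → ℝ → ℝ)
    (hπhat : ∀ n, Measurable (fun w : 𝒯 n × 𝒳 × ℝ => πhat n w.1 w.2.1 w.2.2))
    (hμhat : ∀ n, Measurable (fun w : 𝒯 n × 𝒳 × ℝ => μhat n w.1 w.2.1 w.2.2))
    -- regularity of the nuisance estimates on the kernel window
    (hinthat : ∀ᶠ n in atTop, ∀ᵐ ω ∂Pr,
      TermsIntegrable P (scaledKernel K h) S a t (πhat n (D n ω)) (μhat n (D n ω)))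
    (hpos : ∀ᶠ n in atTop, ∀ᵐ ω ∂Pr, ∀ᵐ v ∂(P.fst.prod volume),
      scaledKernel K h (v.2 - a) ≠ 0 → 0 < πhat n (D n ω) v.1 v.2)
    -- the measure of the `L₂` norm of the nuisance errors; it controls the trimmed weights
    (ν : Measure (𝒳 × ℝ)) (C : ℝ≥0)
    (hν : ∀ᶠ n in atTop, ∀ᵐ ω ∂Pr,
      (P.fst.prod volume).withDensity (fun v => ENNReal.ofReal (|scaledKernel K h (v.2 - a)| *
        (1 + |μ v.1 v.2| + |S (πhat n (D n ω) v.1 v.2) t / πhat n (D n ω) v.1 v.2|))) ≤ C • ν)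
    -- the rate condition
    (hrate : IsLittleOP Pr (fun n ω =>
      (nuisanceDist ν (πhat n (D n ω)) π + nuisanceDist ν (μhat n (D n ω)) μ)
        * nuisanceDist ν (πhat n (D n ω)) π) (fun n => (n : ℝ) ^ (-(1 / 2) : ℝ)))
    -- `L₂(P)`-consistency of the estimated influence functions
    (hconsNum : IsLittleOP Pr (fun n ω => eLpNorm (fun z =>
      eifNum (scaledKernel K h) S a t (πhat n (D n ω)) (μhat n (D n ω)) z
        - eifNum (scaledKernel K h) S a t π μ z) 2 P) (fun _ => 1))
    (hconsDen : IsLittleOP Pr (fun n ω => eLpNorm (fun z =>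
      eifDen (scaledKernel K h) S a t (πhat n (D n ω)) z
        - eifDen (scaledKernel K h) S a t π z) 2 P) (fun _ => 1)) :
    TendstoInDistribution
      (fun (n : ℕ) ω => √n *
        (psiHat (scaledKernel K h) S a t (πhat n (D n ω)) (μhat n (D n ω)) n (fun i => Z i ω)
          - psi P (scaledKernel K h) S a t π μ))
      atTop (id : ℝ → ℝ) (fun _ => Pr)
      (gaussianReal 0 (Var[fun z => (eifNum (scaledKernel K h) S a t π μ z
          - psi P (scaledKernel K h) S a t π μ * eifDen (scaledKernel K h) S a t π z)
          / psiDen P (scaledKernel K h) S a t π; P]).toNNReal) := by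
  have hk : Measurable (scaledKernel K h) := by unfold scaledKernel; fun_prop
  -- With the bandwidth fixed, the kernel is from here on an arbitrary measurable weight.
  generalize scaledKernel K h = k at *
  have hSm := hS.continuous.measurable
  have hdSm := hS₂.continuous.measurable
  have hNhat := fun n => measurable_eifNum (a := a) hk hSm hdSm (hπhat n) (hμhat n)
  have hDhat := fun n => measurable_eifDen (a := a) hk hSm hdSm (hπhat n)
  have hπc : Measurable fun w : Unit × 𝒳 × ℝ => π w.2.1 w.2.2 := hπ.measurable.comp measurable_snd
  have hμc : Measurable fun w : Unit × 𝒳 × ℝ => μ w.2.1 w.2.2 := hμ.measurable.comp measurable_snd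
  have hN : Measurable (eifNum k S a t π μ) :=
    (measurable_eifNum (𝒯 := Unit) (p := fun _ => π) (m := fun _ => μ) hk hSm hdSm hπc hμc).comp
      (measurable_prodMk_left (x := ()))
  have hDn : Measurable (eifDen k S a t π) :=
    (measurable_eifDen (𝒯 := Unit) (p := fun _ => π) hk hSm hdSm hπc).comp
      (measurable_prodMk_left (x := ()))
  have hNmean := integral_eifNum_self hπ hμ hk hSm hdSm hint (hnum2.integrable one_le_two)
  have hDmean := integral_eifDen_self hπ hk hdSm hint (hden2.integrable one_le_two)
  have hp : ∀ n d, Measurable (Function.uncurry (πhat n d)) := fun n d =>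
    (hπhat n).comp measurable_prodMk_left
  have hm : ∀ n d, Measurable (Function.uncurry (μhat n d)) := fun n d =>
    (hμhat n).comp measurable_prodMk_left
  have hRN := tendstoInMeasure_sampleMean_sub (c := C * (1 + L)) hZ hZlaw hZind hD hDind hNhat hN
    hconsNum hrate (by
      filter_upwards [hinthat, hpos, hν] with n h1 h2 h3
      filter_upwards [h1, h2, h3] with ω g1 g2 g3 hL
      -- The estimated influence function is integrable as the true one plus a difference in
      -- `L₂(P)`; no separate moment condition on the estimates is needed.
      have hi : Integrable (eifNum k S a t (πhat n (D n ω)) (μhat n (D n ω))) P := by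
        refine ((hL.add hnum2).integrable one_le_two).congr (.of_forall fun z => ?_)
        simp only [Pi.add_apply, sub_add_cancel]
      rw [integral_sub hi (hnum2.integrable one_le_two), hNmean]
      simpa using enorm_eifNum_bias_le hπ hμ hk hS hS₁ hS₂ hint (hp n _) (hm n _) g1 g2 g3 hi)
  have hRD := tendstoInMeasure_sampleMean_sub (c := C * (1 + L)) hZ hZlaw hZind hD hDind hDhat hDn
    hconsDen hrate (by
      filter_upwards [hinthat, hν] with n h1 h3
      filter_upwards [h1, h3] with ω g1 g3 hL
      have hi : Integrable (eifDen k S a t (πhat n (D n ω))) P := by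
        refine ((hL.add hden2).integrable one_le_two).congr (.of_forall fun z => ?_)
        simp only [Pi.add_apply, sub_add_cancel]
      rw [integral_sub hi (hden2.integrable one_le_two), hDmean]
      simpa using enorm_eifDen_bias_le hπ hμ hk hS hS₂ hint (hp n _) (hm n _) g1 g3 hi)
  have hDZ : ∀ n, Measurable fun ω => (D n ω, fun i => Z i ω) := fun n =>
    (hD n).prodMk (measurable_pi_lambda _ hZ)
  have hfin := tendstoInDistribution_ratio hZ hZlaw hZind hN hDn hnum2 hden2 (by rwa [hDmean])
    (fun n => (measurable_sampleMean (hNhat n) n).comp (hDZ n))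
    (fun n => (measurable_sampleMean (hDhat n) n).comp (hDZ n)) hRN hRD
  rw [hNmean, hDmean] at hfin
  exact hfin
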